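/- Let $\mathcal P$ be the real vector space of harmonic quaternion polynomials, i.e. of pairs $p=\{\alpha,u\}$, where $\alpha$ is a real polynomial in $x_1,x_2,x_3$ and $u=(u_1,u_2,u_3)$ is a vector field on $\mathbb R^3$ with real polynomial components, such that $\nabla\alpha=\operatorname{rot}u$ and $\operatorname{div}u=0$. For a unit vector $\omega\in S^2\subset\mathbb R^3$ let $\mathcal P^\omega\subset\mathcal P$ be the set of those $p=\{\alpha,u\}\in\mathcal P$ that are $\omega$-axial, i.e. $\alpha$ and $u$ are constant on every straight line $\{x_0+t\omega \mid t\in\mathbb R\}$, $x_0\in\mathbb R^3$. Then $$\mathcal P=\operatorname{span}\{\mathcal P^\omega\mid\omega\in S^2\},$$ where span is the set of finite real linear combinations. Moreover, the same equality holds if each $\mathcal P^\omega$ is replaced by its subset of fields of the form $\{\varphi,\psi\omega\}$, with scalar polynomials $\varphi,\psi$. -/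

import Mathlib

noncomputable section

/-- Real polynomials in the three variables of `ℝ³`. -/
abbrev Poly3 : Type := MvPolynomial (Fin 3) ℝ

/-- Quaternion polynomial fields on `ℝ³`: pairs `{α, u}` of a scalar polynomial `α` and a vector
field `u` with polynomial components, with the component-wise real linear structure. -/
abbrev QuatPolyField : Type := Poly3 × (Fin 3 → Poly3)

/-- The gradient of a polynomial. -/
def polyGrad (α : Poly3) : Fin 3 → Poly3 :=
  fun i => MvPolynomial.pderiv i α

/-- The divergence of a polynomial vector field. -/
def polyDiv (u : Fin 3 → Poly3) : Poly3 :=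
  ∑ i, MvPolynomial.pderiv i (u i)

/-- The rotor (curl) of a polynomial vector field. -/
def polyRot (u : Fin 3 → Poly3) : Fin 3 → Poly3 :=
  ![MvPolynomial.pderiv 1 (u 2) - MvPolynomial.pderiv 2 (u 1),
    MvPolynomial.pderiv 2 (u 0) - MvPolynomial.pderiv 0 (u 2),
    MvPolynomial.pderiv 0 (u 1) - MvPolynomial.pderiv 1 (u 0)]

theorem polyGrad_add (α β : Poly3) : polyGrad (α + β) = polyGrad α + polyGrad β := by
  funext i; simp [polyGrad]

theorem polyGrad_smul (c : ℝ) (α : Poly3) : polyGrad (c • α) = c • polyGrad α := by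
  funext i; simp [polyGrad]

theorem polyDiv_add (u v : Fin 3 → Poly3) : polyDiv (u + v) = polyDiv u + polyDiv v := by
  simp [polyDiv, Finset.sum_add_distrib]

theorem polyDiv_smul (c : ℝ) (u : Fin 3 → Poly3) : polyDiv (c • u) = c • polyDiv u := by
  simp [polyDiv, Finset.smul_sum]

theorem polyRot_add (u v : Fin 3 → Poly3) : polyRot (u + v) = polyRot u + polyRot v := by
  funext i; fin_cases i <;> simp [polyRot] <;> ring

theorem polyRot_smul (c : ℝ) (u : Fin 3 → Poly3) : polyRot (c • u) = c • polyRot u := by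
  funext i; fin_cases i <;> simp [polyRot, smul_sub]

/-- The space `𝒫` of harmonic quaternion polynomials: the polynomial fields `{α, u}` with
`∇α = rot u` and `div u = 0`. -/
def harmonicPolyFields : Submodule ℝ QuatPolyField where
  carrier := {p | polyGrad p.1 = polyRot p.2 ∧ polyDiv p.2 = 0}
  zero_mem' := by
    constructor
    · funext i; fin_cases i <;> simp [polyGrad, polyRot]
    · simp [polyDiv]
  add_mem' := by
    rintro p q ⟨hp, hp'⟩ ⟨hq, hq'⟩
    refine ⟨?_, ?_⟩
    · rw [Prod.fst_add, Prod.snd_add, polyGrad_add, polyRot_add, hp, hq]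
    · rw [Prod.snd_add, polyDiv_add, hp', hq', add_zero]
  smul_mem' := by
    rintro c p ⟨hp, hp'⟩
    refine ⟨?_, ?_⟩
    · rw [Prod.smul_fst, Prod.smul_snd, polyGrad_smul, polyRot_smul, hp]
    · rw [Prod.smul_snd, polyDiv_smul, hp', smul_zero]

/-- The unit sphere `S²` in Euclidean `ℝ³`. -/
abbrev UnitSphere2 : Type := Metric.sphere (0 : EuclideanSpace ℝ (Fin 3)) 1

/-- A polynomial is `ω`-axial if it is constant on all straight lines `x₀ + tω`, `t ∈ ℝ`. -/
def IsAxialPoly (ω : EuclideanSpace ℝ (Fin 3)) (α : Poly3) : Prop :=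
  ∀ (x₀ : EuclideanSpace ℝ (Fin 3)) (t : ℝ),
    MvPolynomial.eval (fun i => (x₀ + t • ω) i) α = MvPolynomial.eval (fun i => x₀ i) α

/-- A quaternion polynomial field `{α, u}` is `ω`-axial if `α` and all components of `u` are. -/
def IsAxialField (ω : EuclideanSpace ℝ (Fin 3)) (p : QuatPolyField) : Prop :=
  IsAxialPoly ω p.1 ∧ ∀ i, IsAxialPoly ω (p.2 i)

/-- The `ω`-axial part `𝒫^ω` of `𝒫`: the `ω`-axial harmonic quaternion polynomials. -/
def axialPart (ω : UnitSphere2) : Set QuatPolyField :=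
  {p | p ∈ harmonicPolyFields ∧ IsAxialField ω p}

/-- The `ω`-axial harmonic quaternion polynomials of the form `{φ, ψω}`, i.e. those whose vector
component is everywhere parallel to the axis. -/
def parallelAxialPart (ω : UnitSphere2) : Set QuatPolyField :=
  {p | p ∈ axialPart ω ∧
    ∃ ψ : Poly3, p.2 = fun i => (ω : EuclideanSpace ℝ (Fin 3)) i • ψ}

end

noncomputable section

open MvPolynomial

/-! Solving the system for the ∂₃-derivatives expresses them through ∂₁ and ∂₂ only, so a harmonic
field is determined by its restriction to the plane x₃ = 0 (`eq_zero_of_restrictField_eq_zero`). It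
therefore suffices that restrictions of parallel axial fields exhaust all polynomial fields on that
plane (`restrictField_mem_restrictedSpan`): a combination q agreeing with p there must equal p. The
supply of fields is {Re g, (Im g)ω} with g a power of z = a·x + i b·x, possibly times i, where a, b
are orthogonal to ω and of equal length. On the plane z becomes p + iq with p, q linear in x₁, x₂.
Scalar fields arise when b is normal to the plane, so q = 0. Fields along e₁ or e₂ arise by
subtracting two fields with the same restricted z and mirrored axes; those along e₃ are then what
remains of a single field. Tilting the frame by a parameter t and reading off coefficients in t
isolates the monomials. -/

/-- A submodule containing infinitely many values of a polynomial curve contains the coefficients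
of the curve. -/
theorem Submodule.coeff_mem_of_infinite {K V : Type*} [Field K] [AddCommGroup V] [Module K V]
    (W : Submodule K V) (n : ℕ) (w : ℕ → V) (s : Set K) (hs : s.Infinite)
    (h : ∀ t ∈ s, ∑ j ∈ Finset.range n, t ^ j • w j ∈ W) {j : ℕ} (hj : j < n) : w j ∈ W := by
  by_contra hw
  -- A functional killing W but not `w j` turns the curve into a scalar polynomial with infinitely
  -- many roots.
  obtain ⟨f, hf, hfW⟩ := Submodule.exists_dual_map_eq_bot_of_notMem hw inferInstance
  have hker : ∀ v ∈ W, f v = 0 := fun v hv => by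
    rw [← Submodule.mem_bot (R := K), ← hfW]
    exact Submodule.mem_map_of_mem hv
  set P : Polynomial K := ∑ i ∈ Finset.range n, Polynomial.monomial i (f (w i)) with hP
  have hP0 : P = 0 := by
    refine Polynomial.eq_zero_of_infinite_isRoot P (hs.mono fun t ht => ?_)
    have := hker _ (h t ht)
    simp only [map_sum, map_smul, smul_eq_mul] at this
    simp only [Set.mem_ofPred_eq, Polynomial.IsRoot, hP, Polynomial.eval_finsetSum,
      Polynomial.eval_monomial]
    rw [← this]
    exact Finset.sum_congr rfl fun i _ => mul_comm _ _
  apply hf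
  have hc : P.coeff j = f (w j) := by
    simp [hP, Polynomial.coeff_monomial, hj]
  rw [← hc, hP0, Polynomial.coeff_zero]

/-! ### Complex-valued polynomials -/

/-- Complex-valued polynomials on `ℝ³`, as pairs of a real and an imaginary part. -/
abbrev CPoly3 : Type := QuadraticAlgebra Poly3 (-1) 0

/-- The imaginary unit. -/
def CPoly3.I : CPoly3 := ⟨0, 1⟩

/-- The linear form `x ↦ a · x`. -/
def linForm (a : Fin 3 → ℝ) : Poly3 := ∑ i, C (a i) * X i

theorem pderiv_linForm (a : Fin 3 → ℝ) (i : Fin 3) : pderiv i (linForm a) = C (a i) := by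
  fin_cases i <;> simp [linForm, Fin.sum_univ_three, pderiv_X]

/-- The complex polynomial `g` is a holomorphic function of the complex variable
`a · x + i (b · x)`: its gradient is `D (a + i b)`. -/
def IsHolomorphicIn (a b : Fin 3 → ℝ) (g : CPoly3) : Prop :=
  ∃ D : CPoly3, ∀ i,
    pderiv i g.re = C (a i) * D.re - C (b i) * D.im ∧
    pderiv i g.im = C (a i) * D.im + C (b i) * D.re

theorem isHolomorphicIn_linForm (a b : Fin 3 → ℝ) :
    IsHolomorphicIn a b ⟨linForm a, linForm b⟩ := by
  refine ⟨⟨1, 0⟩, fun i => ?_⟩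
  simp [pderiv_linForm]

theorem isHolomorphicIn_one (a b : Fin 3 → ℝ) : IsHolomorphicIn a b ⟨1, 0⟩ :=
  ⟨⟨0, 0⟩, fun i => by simp⟩

theorem isHolomorphicIn_I (a b : Fin 3 → ℝ) : IsHolomorphicIn a b CPoly3.I :=
  ⟨⟨0, 0⟩, fun i => by simp [CPoly3.I]⟩

theorem IsHolomorphicIn.mul {a b : Fin 3 → ℝ} {g h : CPoly3} (hg : IsHolomorphicIn a b g)
    (hh : IsHolomorphicIn a b h) : IsHolomorphicIn a b (g * h) := by
  obtain ⟨D, hD⟩ := hg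
  obtain ⟨E, hE⟩ := hh
  refine ⟨D * h + g * E, fun i => ?_⟩
  obtain ⟨h1, h2⟩ := hD i
  obtain ⟨h3, h4⟩ := hE i
  simp only [QuadraticAlgebra.re_mul, QuadraticAlgebra.im_mul, QuadraticAlgebra.re_add,
    QuadraticAlgebra.im_add, map_add, zero_mul, neg_mul, one_mul, map_neg, Derivation.leibniz,
    smul_eq_mul, h1, h2, h3, h4]
  constructor <;> simp <;> ring

theorem IsHolomorphicIn.pow {a b : Fin 3 → ℝ} {g : CPoly3} (hg : IsHolomorphicIn a b g) (m : ℕ) :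
    IsHolomorphicIn a b (g ^ m) := by
  induction m with
  | zero => rw [pow_zero]; exact isHolomorphicIn_one a b
  | succ m ih => rw [pow_succ]; exact ih.mul hg

/-! ### Axial complex polynomials -/

/-- A complex polynomial is axial if its real and imaginary parts are. -/
def IsAxialCPoly (ω : EuclideanSpace ℝ (Fin 3)) (g : CPoly3) : Prop :=
  IsAxialPoly ω g.re ∧ IsAxialPoly ω g.im

theorem IsAxialCPoly.mul {ω : EuclideanSpace ℝ (Fin 3)} {g h : CPoly3} (hg : IsAxialCPoly ω g)
    (hh : IsAxialCPoly ω h) : IsAxialCPoly ω (g * h) := by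
  constructor <;> intro x t <;>
    simp only [QuadraticAlgebra.re_mul, QuadraticAlgebra.im_mul, map_add, map_mul, map_neg,
      map_one, map_zero, hg.1 x t, hg.2 x t, hh.1 x t, hh.2 x t]

theorem isAxialCPoly_C (ω : EuclideanSpace ℝ (Fin 3)) (r s : ℝ) :
    IsAxialCPoly ω ⟨C r, C s⟩ := by
  constructor <;> intro x t <;> simp

theorem isAxialCPoly_one (ω : EuclideanSpace ℝ (Fin 3)) : IsAxialCPoly ω 1 := by
  have h := isAxialCPoly_C ω 1 0
  rwa [map_one, map_zero] at h

theorem IsAxialCPoly.pow {ω : EuclideanSpace ℝ (Fin 3)} {g : CPoly3} (hg : IsAxialCPoly ω g)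
    (m : ℕ) : IsAxialCPoly ω (g ^ m) := by
  induction m with
  | zero => rw [pow_zero]; exact isAxialCPoly_one ω
  | succ m ih => rw [pow_succ]; exact ih.mul hg

theorem isAxialPoly_linForm {ω : EuclideanSpace ℝ (Fin 3)} {a : Fin 3 → ℝ}
    (h : ∑ i, a i * ω i = 0) : IsAxialPoly ω (linForm a) := by
  intro x t
  simp only [Fin.sum_univ_three] at h
  simp [linForm, Fin.sum_univ_three]
  linear_combination t * h

/-! ### Parallel axial fields -/

/-- `(a, b, w)` is a positively oriented orthogonal frame with `|a| = |b|` and `|w| = 1`. -/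
structure IsAxialFrame (a b w : Fin 3 → ℝ) : Prop where
  cross_left : crossProduct a w = -b
  cross_right : crossProduct b w = a
  norm_sq : ∑ i, w i ^ 2 = 1

/-- The vector field `f v` with constant direction `v`. -/
def directedField (v : Fin 3 → ℝ) : Poly3 →ₗ[ℝ] QuatPolyField :=
  LinearMap.inr ℝ Poly3 (Fin 3 → Poly3) ∘ₗ LinearMap.pi fun i => v i • LinearMap.id

/-- The scalar field `{f, 0}`. -/
def scalarField : Poly3 →ₗ[ℝ] QuatPolyField := LinearMap.inl ℝ Poly3 (Fin 3 → Poly3)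

/-- The span of the axial fields parallel to their axis. -/
def parallelSpan : Submodule ℝ QuatPolyField :=
  Submodule.span ℝ (⋃ ω : UnitSphere2, parallelAxialPart ω)

/-- With D = g', rot((Im g)w) = ∇Im g × w = (a Im D + b Re D) × w = −b Im D + a Re D = ∇Re g by the
frame relations. The divergence is w·∇Im g = 0 because a and b are orthogonal to w. -/
theorem IsAxialFrame.mem_parallelSpan {a b w : Fin 3 → ℝ} (hf : IsAxialFrame a b w) {g : CPoly3}
    (hg : IsHolomorphicIn a b g) (hax : IsAxialCPoly (WithLp.toLp 2 w) g) :
    scalarField g.re + directedField w g.im ∈ parallelSpan := by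
  obtain ⟨h1, h2, h3⟩ := hf
  simp only [cross_apply] at h1 h2
  have e0 := congrFun h1 0
  have e1 := congrFun h1 1
  have e2 := congrFun h1 2
  have k0 := congrFun h2 0
  have k1 := congrFun h2 1
  have k2 := congrFun h2 2
  simp at e0 e1 e2 k0 k1 k2
  obtain ⟨D, hD⟩ := hg
  have hfld : scalarField g.re + directedField w g.im = (g.re, fun i => w i • g.im) := by
    simp [scalarField, directedField]
    rfl
  have hnorm : WithLp.toLp 2 w ∈ Metric.sphere (0 : EuclideanSpace ℝ (Fin 3)) 1 := by
    simp [EuclideanSpace.norm_eq, h3]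
  rw [hfld]
  refine Submodule.subset_span (Set.mem_iUnion.2 ⟨⟨_, hnorm⟩, ⟨⟨⟨?_, ?_⟩, ⟨hax.1, ?_⟩⟩, g.im, rfl⟩⟩)
  · have e0' := congrArg (C : ℝ → Poly3) e0
    have e1' := congrArg (C : ℝ → Poly3) e1
    have e2' := congrArg (C : ℝ → Poly3) e2
    have k0' := congrArg (C : ℝ → Poly3) k0
    have k1' := congrArg (C : ℝ → Poly3) k1
    have k2' := congrArg (C : ℝ → Poly3) k2
    simp only [map_sub, map_mul, map_neg] at e0' e1' e2' k0' k1' k2'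
    funext i
    fin_cases i <;> simp [polyGrad, polyRot, hD, smul_eq_C_mul]
    · linear_combination -D.im * e0' - D.re * k0'
    · linear_combination -D.im * e1' - D.re * k1'
    · linear_combination -D.im * e2' - D.re * k2'
  · have p1 := congrArg (C : ℝ → Poly3)
      (show a 0 * w 0 + a 1 * w 1 + a 2 * w 2 = 0 by rw [← k0, ← k1, ← k2]; ring)
    have p2 := congrArg (C : ℝ → Poly3)
      (show b 0 * w 0 + b 1 * w 1 + b 2 * w 2 = 0 by
        linear_combination w 0 * e0 + w 1 * e1 + w 2 * e2)
    simp only [map_add, map_mul, map_zero] at p1 p2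
    simp [polyDiv, hD, smul_eq_C_mul, Fin.sum_univ_three]
    linear_combination D.im * p1 + D.re * p2
  · intro i x t
    have := hax.2 x t
    simp only [smul_eval, this]

theorem IsAxialFrame.mul_pow_mem_parallelSpan {a b w : Fin 3 → ℝ} (hf : IsAxialFrame a b w)
    (m : ℕ) {c : CPoly3} (hc : c = 1 ∨ c = CPoly3.I) :
    scalarField (c * ⟨linForm a, linForm b⟩ ^ m).re
      + directedField w (c * ⟨linForm a, linForm b⟩ ^ m).im ∈ parallelSpan := by
  have k : crossProduct b w = a := hf.cross_right
  have e : -crossProduct a w = b := by rw [hf.cross_left, neg_neg]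
  have p1 : ∑ i, a i * (WithLp.toLp 2 w : EuclideanSpace ℝ (Fin 3)) i = 0 := by
    rw [← k]
    simp [Fin.sum_univ_three, cross_apply]
    ring
  have p2 : ∑ i, b i * (WithLp.toLp 2 w : EuclideanSpace ℝ (Fin 3)) i = 0 := by
    rw [← e]
    simp [Fin.sum_univ_three, cross_apply]
    ring
  refine hf.mem_parallelSpan (IsHolomorphicIn.mul ?_ ((isHolomorphicIn_linForm a b).pow m))
    (IsAxialCPoly.mul ?_ (IsAxialCPoly.pow ⟨isAxialPoly_linForm p1, isAxialPoly_linForm p2⟩ m))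
  · rcases hc with rfl | rfl
    · exact isHolomorphicIn_one a b
    · exact isHolomorphicIn_I a b
  · rcases hc with rfl | rfl
    · exact isAxialCPoly_one _
    · simpa [CPoly3.I] using isAxialCPoly_C _ 0 1

/-! ### Restriction to the plane `x₃ = 0` -/

/-- Restriction of a polynomial to the plane `x₃ = 0`. -/
def restrictPoly : Poly3 →ₐ[ℝ] Poly3 := aeval ![X 0, X 1, 0]

/-- Restriction of a field to the plane `x₃ = 0`. -/
def restrictField : QuatPolyField →ₗ[ℝ] QuatPolyField :=
  LinearMap.prodMap restrictPoly.toLinearMap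
    (LinearMap.pi fun i => restrictPoly.toLinearMap ∘ₗ LinearMap.proj i)

/-- The restrictions to `x₃ = 0` of the fields in `parallelSpan`. -/
def restrictedSpan : Submodule ℝ QuatPolyField := parallelSpan.map restrictField

theorem restrictField_scalarField (f : Poly3) :
    restrictField (scalarField f) = scalarField (restrictPoly f) := by
  ext1
  · rfl
  · funext i
    simp [restrictField, scalarField]

theorem restrictField_directedField (v : Fin 3 → ℝ) (f : Poly3) :
    restrictField (directedField v f) = directedField v (restrictPoly f) := by
  ext1
  · simp [restrictField, directedField]
  · funext i
    simp [restrictField, directedField]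

theorem restrictPoly_linForm (a : Fin 3 → ℝ) :
    restrictPoly (linForm a) = C (a 0) * X 0 + C (a 1) * X 1 := by
  simp [restrictPoly, linForm, Fin.sum_univ_three, algebraMap_eq]

theorem restrictPoly_monomial (u : Fin 3 →₀ ℕ) (c : ℝ) :
    restrictPoly (monomial u c) = C c * (X 0 ^ u 0 * X 1 ^ u 1 * 0 ^ u 2) := by
  rw [restrictPoly, aeval_monomial, Finsupp.prod_fintype _ _ fun _ => pow_zero _]
  simp [Fin.prod_univ_three, algebraMap_eq]

theorem restrictPoly_pow (p q : Poly3) (m : ℕ) :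
    restrictPoly ((⟨p, q⟩ : CPoly3) ^ m).re
        = ((⟨restrictPoly p, restrictPoly q⟩ : CPoly3) ^ m).re ∧
      restrictPoly ((⟨p, q⟩ : CPoly3) ^ m).im
        = ((⟨restrictPoly p, restrictPoly q⟩ : CPoly3) ^ m).im := by
  induction m with
  | zero => simp [QuadraticAlgebra.re_one, QuadraticAlgebra.im_one]
  | succ m ih => simp [pow_succ, ih.1, ih.2]

theorem IsAxialFrame.pow_mem_restrictedSpan {a b w : Fin 3 → ℝ} (hf : IsAxialFrame a b w)
    {p q : Poly3} (hp : C (a 0) * X 0 + C (a 1) * X 1 = p)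
    (hq : C (b 0) * X 0 + C (b 1) * X 1 = q) (m : ℕ) :
    scalarField ((⟨p, q⟩ : CPoly3) ^ m).re + directedField w ((⟨p, q⟩ : CPoly3) ^ m).im
        ∈ restrictedSpan ∧
      -scalarField ((⟨p, q⟩ : CPoly3) ^ m).im + directedField w ((⟨p, q⟩ : CPoly3) ^ m).re
        ∈ restrictedSpan := by
  have h := restrictPoly_pow (linForm a) (linForm b) m
  rw [restrictPoly_linForm, restrictPoly_linForm, hp, hq] at h
  have h1 := Submodule.mem_map_of_mem (f := restrictField)
    (hf.mul_pow_mem_parallelSpan m (Or.inl rfl))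
  have h2 := Submodule.mem_map_of_mem (f := restrictField)
    (hf.mul_pow_mem_parallelSpan m (Or.inr rfl))
  rw [map_add, restrictField_scalarField, restrictField_directedField] at h1 h2
  constructor
  · rwa [one_mul, h.1, h.2] at h1
  · have hI : ∀ z : CPoly3, (CPoly3.I * z).re = -z.im ∧ (CPoly3.I * z).im = z.re := fun z => by
      simp [CPoly3.I]
    rwa [(hI _).1, (hI _).2, map_neg, map_neg, h.1, h.2] at h2

/-! ### Extraction of monomials -/

theorem CPoly3.exists_I_pow (n : ℕ) :
    ∃ r s : ℝ, CPoly3.I ^ n = ⟨C r, C s⟩ ∧ r ^ 2 + s ^ 2 = 1 := by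
  induction n with
  | zero => exact ⟨1, 0, by ext1 <;> simp [QuadraticAlgebra.re_one, QuadraticAlgebra.im_one],
      by norm_num⟩
  | succ n ih =>
    obtain ⟨r, s, h, hrs⟩ := ih
    refine ⟨-s, r, ?_, by linarith⟩
    rw [pow_succ, h]
    ext1 <;> simp [CPoly3.I]

/-- The coefficient of t^l in (tp + iq)^n is a binomial multiple of p^l q^(n−l) i^(n−l). Real and
imaginary parts are both required because the parity of n − l decides which one carries the
monomial. -/
theorem pow_mul_pow_mem_of_forall_pow {V : Type*} [AddCommGroup V] [Module ℝ V]
    (W : Submodule ℝ V) (L : Poly3 →ₗ[ℝ] V) (p q : Poly3) (s : Set ℝ) (hs : s.Infinite) (j k : ℕ)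
    (hre : ∀ t ∈ s, L ((⟨C t * p, q⟩ : CPoly3) ^ (j + k)).re ∈ W)
    (him : ∀ t ∈ s, L ((⟨C t * p, q⟩ : CPoly3) ^ (j + k)).im ∈ W) :
    L (p ^ j * q ^ k) ∈ W := by
  choose r i hI hri using CPoly3.exists_I_pow
  have hexp : ∀ t : ℝ, (⟨C t * p, q⟩ : CPoly3) ^ (j + k) =
      ∑ l ∈ Finset.range (j + k + 1),
        t ^ l • (((j + k).choose l : ℝ) •
          ((p ^ l * q ^ (j + k - l)) • CPoly3.I ^ (j + k - l))) := by
    intro t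
    have h0 : (⟨C t * p, q⟩ : CPoly3) =
        algebraMap Poly3 CPoly3 (C t * p) + algebraMap Poly3 CPoly3 q * CPoly3.I := by
      ext1 <;> simp [CPoly3.I]
    rw [h0, add_pow]
    refine Finset.sum_congr rfl fun l _ => ?_
    rw [Algebra.smul_def (_ : ℝ), Algebra.smul_def (_ : ℝ),
      Algebra.smul_def (_ : Poly3), IsScalarTower.algebraMap_apply ℝ Poly3 CPoly3,
      IsScalarTower.algebraMap_apply ℝ Poly3 CPoly3]
    simp only [mul_pow, map_mul, map_natCast, map_pow, algebraMap_eq]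
    ring
  have hre' := fun l hl => Submodule.coeff_mem_of_infinite W (j + k + 1)
    (fun l => ((j + k).choose l : ℝ) • r (j + k - l) • L (p ^ l * q ^ (j + k - l))) s hs
    (fun t ht => by
      have := hre t ht
      rw [hexp, ← QuadraticAlgebra.reₗ_apply, map_sum, map_sum] at this
      convert this using 2 with l
      simp [hI, mul_comm _ (C _), ← smul_eq_C_mul]) (j := l) hl
  have him' := fun l hl => Submodule.coeff_mem_of_infinite W (j + k + 1)
    (fun l => ((j + k).choose l : ℝ) • i (j + k - l) • L (p ^ l * q ^ (j + k - l))) s hs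
    (fun t ht => by
      have := him t ht
      rw [hexp, ← QuadraticAlgebra.imₗ_apply, map_sum, map_sum] at this
      convert this using 2 with l
      simp [hI, mul_comm _ (C _), ← smul_eq_C_mul]) (j := l) hl
  have hj : j < j + k + 1 := by omega
  have hch : ((j + k).choose j : ℝ) ≠ 0 := by
    exact_mod_cast (Nat.choose_pos (Nat.le_add_right j k)).ne'
  have h1 := (Submodule.smul_mem_iff _ hch).1 (hre' j hj)
  have h2 := (Submodule.smul_mem_iff _ hch).1 (him' j hj)
  rw [Nat.add_sub_cancel_left] at h1 h2
  -- Weighting the two parts by r and i gives the factor r² + i² = 1, avoiding a case split on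
  -- parity.
  have h3 := W.add_mem (W.smul_mem (r k) h1) (W.smul_mem (i k) h2)
  rwa [smul_smul, smul_smul, ← add_smul, ← sq, ← sq, hri, one_smul] at h3

theorem apply_restrictPoly_mem {V : Type*} [AddCommGroup V] [Module ℝ V]
    (W : Submodule ℝ V) (L : Poly3 →ₗ[ℝ] V)
    (h : ∀ j k : ℕ, L (X 0 ^ j * X 1 ^ k) ∈ W) (f : Poly3) : L (restrictPoly f) ∈ W := by
  induction f using MvPolynomial.induction_on' with
  | add f g hf hg => rw [map_add, map_add]; exact W.add_mem hf hg
  | monomial u c =>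
    rw [← mul_one c, ← smul_eq_mul, ← smul_monomial, map_smul, map_smul]
    refine W.smul_mem c ?_
    rw [restrictPoly_monomial, map_one, one_mul]
    rcases Nat.eq_zero_or_pos (u 2) with h2 | h2
    · rw [h2, pow_zero, mul_one]
      exact h _ _
    · rw [zero_pow h2.ne', mul_zero, map_zero]
      exact W.zero_mem

/-! ### Restrictions of axial fields fill the plane -/

theorem scalarField_restrictPoly_mem (f : Poly3) :
    scalarField (restrictPoly f) ∈ restrictedSpan := by
  refine apply_restrictPoly_mem _ _ (fun j k => ?_) f
  have hmem : ∀ t ∈ (Set.univ : Set ℝ), ∑ l ∈ Finset.range (k + j + 1),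
      t ^ l • (((k + j).choose l : ℝ) • scalarField (X 1 ^ l * X 0 ^ (k + j - l)))
        ∈ restrictedSpan := by
    intro t _
    set σ := Real.sqrt (1 + t ^ 2) with hσ
    have hpos : 0 < 1 + t ^ 2 := by positivity
    have hσ2 : σ ^ 2 = 1 + t ^ 2 := Real.sq_sqrt hpos.le
    have hσ0 : σ ≠ 0 := (Real.sqrt_pos.2 hpos).ne'
    -- Here b is normal to the plane, so z restricts to the real form x₁ + t x₂ and the directed
    -- part drops out; σ = |a| is forced by |b| = |a|.
    have hf : IsAxialFrame ![1, t, 0] ![0, 0, σ] ![t / σ, -1 / σ, 0] := by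
      refine ⟨?_, ?_, ?_⟩
      · funext i
        fin_cases i <;> simp [cross_apply]
        field_simp
        linarith
      · funext i
        fin_cases i <;> simp [cross_apply] <;> field_simp
      · simp [Fin.sum_univ_three]
        field_simp
        linarith
    have h := (hf.pow_mem_restrictedSpan (p := C t * X 1 + X 0) (q := 0)
      (by simp [add_comm]) (by simp) (k + j)).1
    have hpow : (⟨C t * X 1 + X 0, 0⟩ : CPoly3) ^ (k + j) = ⟨(C t * X 1 + X 0) ^ (k + j), 0⟩ :=
      (QuadraticAlgebra.C_pow _ _).symm
    rw [hpow, map_zero, add_zero, add_pow, map_sum] at h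
    convert h using 2 with l
    rw [← map_smul, ← map_smul]
    simp only [smul_eq_C_mul, mul_pow, map_pow, map_natCast]
    congr 1
    ring
  have h := Submodule.coeff_mem_of_infinite _ _ _ _ Set.infinite_univ hmem
    (j := k) (by omega)
  have hch : ((k + j).choose k : ℝ) ≠ 0 := by
    exact_mod_cast (Nat.choose_pos (Nat.le_add_right k j)).ne'
  have h1 := (Submodule.smul_mem_iff _ hch).1 h
  rwa [Nat.add_sub_cancel_left, mul_comm] at h1

theorem directedField_eq_smul_add (v w : Fin 3 → ℝ) (r s : ℝ) (f : Poly3) :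
    directedField (r • v + s • w) f = r • directedField v f + s • directedField w f := by
  ext1
  · simp [directedField]
  · funext i
    simp [directedField, add_smul, smul_smul]

/-- If two frames induce the same complex variable `p + i q` on the plane and their axes differ by
a nonzero multiple of `e`, then the powers of `p + i q` directed along `e` are in the restricted
span. -/
theorem directedField_mem_of_frames {a a' b w w' e : Fin 3 → ℝ} {σ : ℝ} (hσ : σ ≠ 0)
    (hf : IsAxialFrame a b w) (hf' : IsAxialFrame a' b w') (hw : w = w' + σ • e)
    {p q : Poly3} (hp : C (a 0) * X 0 + C (a 1) * X 1 = p)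
    (hp' : C (a' 0) * X 0 + C (a' 1) * X 1 = p)
    (hq : C (b 0) * X 0 + C (b 1) * X 1 = q) (m : ℕ) :
    directedField e ((⟨p, q⟩ : CPoly3) ^ m).re ∈ restrictedSpan ∧
      directedField e ((⟨p, q⟩ : CPoly3) ^ m).im ∈ restrictedSpan := by
  have h := hf.pow_mem_restrictedSpan hp hq m
  have h' := hf'.pow_mem_restrictedSpan hp' hq m
  have hd : ∀ f, directedField w f = directedField w' f + σ • directedField e f := fun f => by
    have := directedField_eq_smul_add w' e 1 σ f
    rwa [one_smul, one_smul, ← hw] at this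
  constructor
  · have := sub_mem h.2 h'.2
    rw [hd] at this
    refine (Submodule.smul_mem_iff _ hσ).1 ?_
    convert this using 1
    abel
  · have := sub_mem h.1 h'.1
    rw [hd] at this
    refine (Submodule.smul_mem_iff _ hσ).1 ?_
    convert this using 1
    abel

theorem infinite_Ioo_zero_one : (Set.Ioo (0 : ℝ) 1).Infinite := Set.Ioo_infinite one_pos

theorem exists_sq_add_sq_eq_one {t : ℝ} (ht : t ∈ Set.Ioo (0 : ℝ) 1) :
    ∃ σ : ℝ, σ ≠ 0 ∧ t ^ 2 + σ ^ 2 = 1 := by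
  have hpos : 0 < 1 - t ^ 2 := by nlinarith [ht.1, ht.2]
  exact ⟨Real.sqrt (1 - t ^ 2), (Real.sqrt_pos.2 hpos).ne', by rw [Real.sq_sqrt hpos.le]; ring⟩

theorem isAxialFrame_zero {t σ : ℝ} (h : t ^ 2 + σ ^ 2 = 1) :
    IsAxialFrame ![t, 0, σ] ![0, 1, 0] ![-σ, 0, t] := by
  refine ⟨?_, ?_, ?_⟩
  · funext i
    fin_cases i <;> simp [cross_apply]
    linarith
  · funext i
    fin_cases i <;> simp [cross_apply]
  · simp [Fin.sum_univ_three]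
    linarith

theorem isAxialFrame_one {t σ : ℝ} (h : t ^ 2 + σ ^ 2 = 1) :
    IsAxialFrame ![0, t, σ] ![-1, 0, 0] ![0, -σ, t] := by
  refine ⟨?_, ?_, ?_⟩
  · funext i
    fin_cases i <;> simp [cross_apply]
    linarith
  · funext i
    fin_cases i <;> simp [cross_apply]
  · simp [Fin.sum_univ_three]
    linarith

/-- Replacing σ by −σ reflects the frame in the plane x₁ = 0 up to sign: z still restricts to t x₁ +
i x₂, while the axes (±σ, 0, t) differ by 2σe₁. -/
theorem directedField_zero_restrictPoly_mem (f : Poly3) :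
    directedField ![1, 0, 0] (restrictPoly f) ∈ restrictedSpan := by
  refine apply_restrictPoly_mem _ _ (fun j k => ?_) f
  have key : ∀ t ∈ Set.Ioo (0 : ℝ) 1,
      directedField ![1, 0, 0] ((⟨C t * X 0, X 1⟩ : CPoly3) ^ (j + k)).re ∈ restrictedSpan ∧
      directedField ![1, 0, 0] ((⟨C t * X 0, X 1⟩ : CPoly3) ^ (j + k)).im ∈ restrictedSpan := fun t ht => by
    obtain ⟨σ, hσ, h⟩ := exists_sq_add_sq_eq_one ht
    exact directedField_mem_of_frames (e := ![1, 0, 0]) (σ := 2 * σ) (by simpa using hσ)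
      (isAxialFrame_zero (σ := -σ) (by simpa using h)) (isAxialFrame_zero h)
      (by funext i; fin_cases i <;> simp; ring) (p := C t * X 0) (q := X 1)
      (by simp) (by simp) (by simp) (j + k)
  exact pow_mul_pow_mem_of_forall_pow _ _ _ _ _ infinite_Ioo_zero_one j k
    (fun t ht => (key t ht).1) (fun t ht => (key t ht).2)

theorem directedField_one_restrictPoly_mem (f : Poly3) :
    directedField ![0, 1, 0] (restrictPoly f) ∈ restrictedSpan := by
  refine apply_restrictPoly_mem _ _ (fun j k => ?_) f
  have key : ∀ t ∈ Set.Ioo (0 : ℝ) 1,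
      directedField ![0, 1, 0] ((⟨C t * X 1, -X 0⟩ : CPoly3) ^ (k + j)).re ∈ restrictedSpan ∧
      directedField ![0, 1, 0] ((⟨C t * X 1, -X 0⟩ : CPoly3) ^ (k + j)).im ∈ restrictedSpan := fun t ht => by
    obtain ⟨σ, hσ, h⟩ := exists_sq_add_sq_eq_one ht
    exact directedField_mem_of_frames (e := ![0, 1, 0]) (σ := 2 * σ) (by simpa using hσ)
      (isAxialFrame_one (σ := -σ) (by simpa using h)) (isAxialFrame_one h)
      (by funext i; fin_cases i <;> simp; ring) (p := C t * X 1) (q := -X 0)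
      (by simp) (by simp) (by simp) (k + j)
  have h := pow_mul_pow_mem_of_forall_pow restrictedSpan (directedField ![0, 1, 0]) (X 1) (-X 0)
    _ infinite_Ioo_zero_one k j (fun t ht => (key t ht).1) (fun t ht => (key t ht).2)
  -- The orientation of the frame forces q = −x₁, which costs only a sign (−1)^j.
  rw [neg_pow, mul_left_comm, mul_comm (X 1 ^ k)] at h
  rcases neg_one_pow_eq_or Poly3 j with hj | hj <;> rw [hj] at h
  · simpa using h
  · simpa using h

theorem directedField_two_restrictPoly_mem (f : Poly3) :
    directedField ![0, 0, 1] (restrictPoly f) ∈ restrictedSpan := by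
  refine apply_restrictPoly_mem _ _ (fun j k => ?_) f
  have key : ∀ t ∈ Set.Ioo (0 : ℝ) 1,
      directedField ![0, 0, 1] ((⟨C t * X 0, X 1⟩ : CPoly3) ^ (j + k)).re ∈ restrictedSpan ∧
      directedField ![0, 0, 1] ((⟨C t * X 0, X 1⟩ : CPoly3) ^ (j + k)).im ∈ restrictedSpan := by
    intro t ht
    obtain ⟨σ, hσ, h⟩ := exists_sq_add_sq_eq_one ht
    have hmem := (isAxialFrame_zero h).pow_mem_restrictedSpan (p := C t * X 0) (q := X 1)
      (by simp) (by simp) (j + k)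
    -- The powers are fixed by restriction, so the results for scalar and e₁-directed fields apply
    -- to them and can be subtracted; the axis −σe₁ + te₃ then leaves t times the e₃ part.
    have hfix := restrictPoly_pow (C t * X 0) (X 1) (j + k)
    have hp : restrictPoly (C t * X 0) = C t * X 0 := by simp [restrictPoly, algebraMap_eq]
    have hq : restrictPoly (X 1) = X 1 := by simp [restrictPoly]
    rw [hp, hq] at hfix
    have hw : (![-σ, 0, t] : Fin 3 → ℝ) = (-σ) • ![1, 0, 0] + t • ![0, 0, 1] := by
      funext i; fin_cases i <;> simp
    rw [hw, directedField_eq_smul_add, directedField_eq_smul_add, ← hfix.1, ← hfix.2] at hmem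
    rw [← hfix.1, ← hfix.2]
    have ht0 : t ≠ 0 := ht.1.ne'
    have hz := fun f => restrictedSpan.smul_mem (-σ) (directedField_zero_restrictPoly_mem f)
    constructor
    · exact (Submodule.smul_mem_iff _ ht0).1 <| (Submodule.add_mem_iff_right _ (hz _)).1 <|
        (Submodule.add_mem_iff_right _ (neg_mem (scalarField_restrictPoly_mem _))).1 hmem.2
    · exact (Submodule.smul_mem_iff _ ht0).1 <| (Submodule.add_mem_iff_right _ (hz _)).1 <|
        (Submodule.add_mem_iff_right _ (scalarField_restrictPoly_mem _)).1 hmem.1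
  exact pow_mul_pow_mem_of_forall_pow _ _ _ _ _ infinite_Ioo_zero_one j k
    (fun t ht => (key t ht).1) (fun t ht => (key t ht).2)

theorem restrictField_mem_restrictedSpan (p : QuatPolyField) :
    restrictField p ∈ restrictedSpan := by
  have h : p = scalarField p.1 + directedField ![1, 0, 0] (p.2 0)
      + directedField ![0, 1, 0] (p.2 1) + directedField ![0, 0, 1] (p.2 2) := by
    ext1
    · simp [scalarField, directedField]
    · funext i
      fin_cases i <;> simp [scalarField, directedField]
  rw [h]
  simp only [map_add, restrictField_scalarField, restrictField_directedField]
  exact add_mem (add_mem (add_mem (scalarField_restrictPoly_mem _)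
    (directedField_zero_restrictPoly_mem _)) (directedField_one_restrictPoly_mem _))
    (directedField_two_restrictPoly_mem _)

/-! ### A harmonic field is determined by its restriction to a plane -/

theorem coeff_restrictPoly (f : Poly3) {s : Fin 3 →₀ ℕ} (hs : s 2 = 0) :
    coeff s (restrictPoly f) = coeff s f := by
  induction f using MvPolynomial.induction_on' with
  | add f g hf hg => simp [hf, hg]
  | monomial u c =>
    have h : restrictPoly (monomial u c) = if u 2 = 0 then monomial u c else 0 := by
      split_ifs with h2
      · rw [restrictPoly_monomial, monomial_eq, Finsupp.prod_fintype _ _ fun _ => pow_zero _]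
        simp [Fin.prod_univ_three, h2]
      · rw [restrictPoly_monomial, zero_pow h2, mul_zero, mul_zero]
    rw [h]
    split_ifs with h2
    · rfl
    · have : u ≠ s := by rintro rfl; exact h2 hs
      simp [coeff_monomial, this]

/-- All coefficients of `f` of degree less than `n` in `x₃` vanish. -/
def VanishesToOrder (n : ℕ) (f : Poly3) : Prop := ∀ s : Fin 3 →₀ ℕ, s 2 < n → coeff s f = 0

theorem VanishesToOrder.sub {n : ℕ} {f g : Poly3} (hf : VanishesToOrder n f)
    (hg : VanishesToOrder n g) : VanishesToOrder n (f - g) := fun s hs => by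
  rw [coeff_sub, hf s hs, hg s hs, sub_zero]

theorem VanishesToOrder.pderiv {n : ℕ} {f : Poly3} (hf : VanishesToOrder n f) {i : Fin 3}
    (hi : i ≠ 2) : VanishesToOrder n (pderiv i f) := fun s hs => by
  rw [coeff_pderiv, hf _ (by simpa [Finsupp.single_apply, hi] using hs), zero_mul]

/-- Coefficients free of x₃ are seen by the restriction; any other one, times its nonzero
x₃-exponent, is a coefficient of ∂₃f. -/
theorem VanishesToOrder.succ {n : ℕ} {f : Poly3} (h0 : restrictPoly f = 0)
    (hf : VanishesToOrder n (MvPolynomial.pderiv 2 f)) : VanishesToOrder (n + 1) f := fun s hs => by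
  rcases Nat.eq_zero_or_pos (s 2) with h2 | h2
  · rw [← coeff_restrictPoly f h2, h0, coeff_zero]
  · have hle : Finsupp.single 2 1 ≤ s := by
      rw [Finsupp.single_le_iff]; exact h2
    have h := hf (s - Finsupp.single 2 1) (by simp; omega)
    rw [coeff_pderiv, tsub_add_cancel_of_le hle] at h
    exact (mul_eq_zero.1 h).resolve_right (by positivity)

/-- Cauchy–Kovalevskaya uniqueness: tangential derivatives preserve the vanishing order in x₃, and
the equations pass that order to ∂₃ of every component, so the order grows without bound. -/
theorem eq_zero_of_restrictField_eq_zero {p : QuatPolyField} (hp : p ∈ harmonicPolyFields)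
    (h : restrictField p = 0) : p = 0 := by
  obtain ⟨α, u⟩ := p
  obtain ⟨hrot, hdiv⟩ := hp
  have hα : restrictPoly α = 0 := congrArg Prod.fst h
  have hu : ∀ i, restrictPoly (u i) = 0 := fun i => congrFun (congrArg Prod.snd h) i
  have r0 := congrFun hrot 0
  have r1 := congrFun hrot 1
  have r2 := congrFun hrot 2
  simp only [polyGrad, polyRot, polyDiv, Fin.sum_univ_three, Matrix.cons_val] at r0 r1 r2 hdiv
  have key : ∀ n, VanishesToOrder n α ∧ ∀ i, VanishesToOrder n (u i) := by
    intro n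
    induction n with
    | zero => exact ⟨fun s hs => absurd hs (by omega), fun i s hs => absurd hs (by omega)⟩
    | succ n ih =>
      obtain ⟨ha, hv⟩ := ih
      have d (i j : Fin 3) (hi : i ≠ 2) := (hv j).pderiv hi
      -- Negations are written as 0 − f, so closure under subtraction suffices.
      have z : VanishesToOrder n 0 := fun s _ => coeff_zero s
      have e2 : pderiv 2 (u 2) = 0 - pderiv 0 (u 0) - pderiv 1 (u 1) := by
        linear_combination hdiv
      have e1 : pderiv 2 (u 1) = pderiv 1 (u 2) - pderiv 0 α := by linear_combination r0
      have e0 : pderiv 2 (u 0) = pderiv 0 (u 2) - (0 - pderiv 1 α) := by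
        linear_combination -r1
      refine ⟨.succ hα ?_, fun i => .succ (hu i) ?_⟩
      · rw [r2]
        exact (d 0 1 (by decide)).sub (d 1 0 (by decide))
      · fin_cases i
        · simp only [Fin.zero_eta, e0]
          exact (d 0 2 (by decide)).sub (z.sub (ha.pderiv (by decide)))
        · simp only [Fin.mk_one, e1]
          exact (d 1 2 (by decide)).sub (ha.pderiv (by decide))
        · simp only [Fin.reduceFinMk, e2]
          exact (z.sub (d 0 0 (by decide))).sub (d 1 1 (by decide))
  ext1
  · exact MvPolynomial.ext _ _ fun s => (key (s 2 + 1)).1 s (Nat.lt_succ_self _)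
  · funext i
    exact MvPolynomial.ext _ _ fun s => (key (s 2 + 1)).2 i s (Nat.lt_succ_self _)

theorem harmonicPolyFields_le_parallelSpan : harmonicPolyFields ≤ parallelSpan := by
  intro p hp
  obtain ⟨q, hq, hqp⟩ := restrictField_mem_restrictedSpan p
  have hle : parallelSpan ≤ harmonicPolyFields :=
    Submodule.span_le.2 (Set.iUnion_subset fun _ _ h => h.1.1)
  have : p - q = 0 := eq_zero_of_restrictField_eq_zero (sub_mem hp (hle hq)) (by
    rw [map_sub, hqp, sub_self])
  rwa [sub_eq_zero.1 this]

theorem lemma2 :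
    harmonicPolyFields =
        Submodule.span ℝ (⋃ ω : UnitSphere2, axialPart ω) ∧
      harmonicPolyFields =
        Submodule.span ℝ (⋃ ω : UnitSphere2, parallelAxialPart ω) := by
  have h1 : parallelSpan ≤ Submodule.span ℝ (⋃ ω : UnitSphere2, axialPart ω) :=
    Submodule.span_mono (Set.iUnion_mono fun _ _ h => h.1)
  have h2 : Submodule.span ℝ (⋃ ω : UnitSphere2, axialPart ω) ≤ harmonicPolyFields :=
    Submodule.span_le.2 (Set.iUnion_subset fun _ _ h => h.1)
  exact ⟨le_antisymm (harmonicPolyFields_le_parallelSpan.trans h1) h2,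
    le_antisymm harmonicPolyFields_le_parallelSpan (h1.trans h2)⟩

end
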